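/- Let $\mathrm{PF}(m,n)$ be the set of parking functions with $m$ cars and $n$ spots: the sequences $\pi=(\pi_1,\dots,\pi_m)\in\{1,\dots,n\}^m$ such that, when the cars $1,\dots,m$ arrive in this order and car $j$ parks in the first spot numbered at least $\pi_j$ that is still free, all $m$ cars succeed in parking. For $\pi\in \mathrm{PF}(m,n)$ let $k_1(\pi)<\dots<k_{n-m}(\pi)$ be the spots that no car attempts, where a car attempts all spots from its preferred one up to the one in which it parks. Let $i\ge 1$ be an integer and $0<c<1$, and let $m=m_N$ and $n=n_N$ be sequences of natural numbers with $n\to\infty$ and $m/n\to c$ as $N\to\infty$ (in particular, $m=cn$ is allowed whenever $cn$ is an integer). For $\pi$ chosen uniformly at random from $\mathrm{PF}(m,n)$ (which, with $\pi_1$ and $k_i$, is well defined for all large $N$), $$\mathrm{Cov}(\pi_1,k_i)\sim-\frac{i}{2(1-c)^2}\qquad (N\to\infty),$$ that is, the ratio of the two sides tends to $1$. -/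

import Mathlib

open Filter Topology ProbabilityTheory Asymptotics

/-!  Parking spots are the elements of `Fin n`, so the spot numbered `k` with `1 ≤ k ≤ n` in the
usual convention is the element of `Fin n` with value `k - 1`. A preference list of `m` cars is a
function `Fin m → Fin n`. -/

/-- `τ` records where the cars park: car `j` parks in the first spot at or after its preferred
spot `π j` that was not taken by an earlier car. (Such a `τ` is unique if it exists.) -/
def IsParkingOutcome {m n : ℕ} (π τ : Fin m → Fin n) : Prop :=
  ∀ j, IsLeast {s : Fin n | π j ≤ s ∧ ∀ l < j, τ l ≠ s} (τ j)

/-- The set `PF(m, n)` of parking functions with `m` cars and `n` spots: the preference lists for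
which all cars successfully park. -/
def parkingFunctions (m n : ℕ) : Set (Fin m → Fin n) :=
  {π | ∃ τ, IsParkingOutcome π τ}

/-- `k` is the number (in `1, …, n`) of a spot that no car attempts: car `j` attempts the spots
from its preferred spot `π j` up to the spot `τ j` in which it parks. -/
def IsUnattempted {m n : ℕ} (π : Fin m → Fin n) (k : ℕ) : Prop :=
  ∃ s : Fin n, (s : ℕ) + 1 = k ∧
    ∃ τ, IsParkingOutcome π τ ∧ ∀ j, ¬(π j ≤ s ∧ s ≤ τ j)

/-- `k_i(π)`, the `i`-th smallest unattempted spot number, for `1 ≤ i ≤ n - m`. (`Nat.nth` counts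
from `0`.) -/
noncomputable def unattemptedSpot {m n : ℕ} (i : ℕ) (π : Fin m → Fin n) : ℕ :=
  Nat.nth (IsUnattempted π) (i - 1)

/-- `π_1`, the number (in `1, …, n`) of the spot preferred by the first car (and `0` if there is
no car). -/
def firstCoordinate {m n : ℕ} (π : Fin m → Fin n) : ℕ :=
  if h : 0 < m then (π ⟨0, h⟩ : ℕ) + 1 else 0

/-- `Cov(π_1, k_i)` for `π` uniformly distributed on `PF(m, n)`. -/
noncomputable def covFirstSpot (m n i : ℕ) : ℝ :=
  cov[fun π : Fin m → Fin n => (firstCoordinate π : ℝ),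
    fun π : Fin m → Fin n => (unattemptedSpot i π : ℝ);
    uniformOn (parkingFunctions m n)]

/-!
Which spots stay vacant does not depend on the order of the cars: in an unbounded row, spot `s`
stays vacant if and only if at most `s - a` cars prefer a spot in `[a, s]`, for every `a ≤ s`
(`IsParked.vacant_iff`). A preference list on `n` spots is a parking function if the spot after the
row stays vacant, and the unattempted spots are the vacant ones.

Cutting at a vacant spot splits a parking function into two independent ones
(`sum_parkFun_split`). Let `d = n + 1 - m` be the number of blocks, each consisting of consecutive
occupied spots and the vacant spot after them, and let `M = n + 1` be the sum of the block lengths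
`t_1, …, t_d`. Given which cars belong to which block, the blocks are independent, so the
exponential generating function for `d` blocks is `F ^ d`, where `F` belongs to one block. In this
calculus a weight by the number of cars is an application of the Euler derivation `X d/dX`.

Given the blocks, the mean of `π_1` is a symmetric function of the lengths minus
`(1 / m) ∑ (d - l) t_l`. The `t_l` are exchangeable with constant sum, so the symmetric part is
uncorrelated with each `t_l`, and `Cov(t_l, t_j) = -Var(t_1) / (d - 1)` for `l ≠ j`. Thus
`Cov(π_1, k_i) = - i d (d - i) Var(t_1) / (2 m (d - 1))`. In terms of generating functions the
symmetric part is the series of preference sums for one block, which need not be known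
(`two_mul_egf_parkSum`, `sum_nth_vacant_mul_sum_sub`).

For the variance, removing a car gives `|PF(m, n)| = d M ^ (m - 1)` (`parkCount_eq`). The second
moment of `t_1` is then a sum of Abel's type, equal to
`(M / d) ∑ (k + 1) m (m - 1) ⋯ (m - k + 1) / M ^ k` (`sum_sq_first_vacant`). By dominated convergence
the last sum tends to `∑ (k + 1) c ^ k = 1 / (1 - c) ^ 2` (`tendsto_momentSum`), so `Var(t_1)` tends
to `c / (1 - c) ^ 3`, and the exact formula `covFirstSpot_eq` gives the limit.
-/

/-! ### Vacant spots -/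

/-- Car `j` prefers spot `f j`, counted from `0` in an unbounded row. `Vacant f s` says that spot
`s` stays empty; as the preferences in `[a, s]` then fill spots of `[a, s)`, there are at most
`s - a` of them, and this order-free condition is also sufficient. -/
def Vacant {ι : Type*} [Fintype ι] (f : ι → ℕ) (s : ℕ) : Prop :=
  ∀ a ≤ s, (Finset.univ.filter fun j => a ≤ f j ∧ f j ≤ s).card + a ≤ s

/-- `τ` is a way to park with preferences `f`, for some order of arrival: the cars get distinct
spots, and every spot between `f j` and `τ j` is occupied in the end. -/
structure IsParked {ι : Type*} (f τ : ι → ℕ) : Prop where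
  inj : Function.Injective τ
  le : ∀ j, f j ≤ τ j
  mem_range : ∀ j s, f j ≤ s → s ≤ τ j → s ∈ Set.range τ

theorem exists_isLeast_outcome {m : ℕ} (f : Fin m → ℕ) :
    ∃ τ : Fin m → ℕ, ∀ j, IsLeast {s | f j ≤ s ∧ ∀ l < j, τ l ≠ s} (τ j) := by
  induction m with
  | zero => exact ⟨Fin.elim0, fun j => j.elim0⟩
  | succ m ih =>
    obtain ⟨τ, hτ⟩ := ih (fun j => f j.castSucc)
    have hne : ∃ s, f (Fin.last m) ≤ s ∧ ∀ l, τ l ≠ s := by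
      obtain ⟨s, hs⟩ := Infinite.exists_notMem_finset
        (Finset.range (f (Fin.last m)) ∪ Finset.univ.image τ)
      simp only [Finset.mem_union, Finset.mem_range, Finset.mem_image, Finset.mem_univ, true_and,
        not_or, not_lt, not_exists] at hs
      exact ⟨s, hs⟩
    classical
    refine ⟨Fin.snoc τ (Nat.find hne), fun j => ?_⟩
    refine Fin.lastCases ?_ (fun j => ?_) j
    · refine ⟨⟨?_, ?_⟩, ?_⟩
      · simpa using (Nat.find_spec hne).1
      · intro l hl
        obtain ⟨l, rfl⟩ := Fin.exists_castSucc_eq.2 hl.ne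
        simpa using (Nat.find_spec hne).2 l
      · rintro s ⟨h1, h2⟩
        simp only [Fin.snoc_last]
        refine Nat.find_min' hne ⟨h1, fun l => ?_⟩
        simpa using h2 l.castSucc (Fin.castSucc_lt_last l)
    · refine ⟨⟨?_, ?_⟩, ?_⟩
      · simpa using (hτ j).1.1
      · intro l hl
        obtain ⟨l, rfl⟩ := Fin.exists_castSucc_eq.2 (hl.trans (Fin.castSucc_lt_last j)).ne
        simpa using (hτ j).1.2 l (by simpa using hl)
      · rintro s ⟨h1, h2⟩
        simp only [Fin.snoc_castSucc]
        refine (hτ j).2 ⟨h1, fun l hl => ?_⟩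
        simpa using h2 l.castSucc (by simpa using hl)

theorem isParked_of_isLeast {m : ℕ} {f τ : Fin m → ℕ}
    (h : ∀ j, IsLeast {s | f j ≤ s ∧ ∀ l < j, τ l ≠ s} (τ j)) : IsParked f τ where
  inj := by
    intro i j hij
    by_contra hne
    rcases lt_or_gt_of_ne hne with hlt | hlt
    · exact (h j).1.2 i hlt hij
    · exact (h i).1.2 j hlt hij.symm
  le j := (h j).1.1
  mem_range j s h1 h2 := by
    by_contra hs
    have := (h j).2 ⟨h1, fun l _ hl => hs ⟨l, hl⟩⟩
    exact hs ⟨j, le_antisymm this h2 |>.symm ▸ rfl⟩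

theorem exists_isParked {ι : Type*} [Fintype ι] (f : ι → ℕ) : ∃ τ, IsParked f τ := by
  let e := Fintype.equivFin ι
  obtain ⟨τ, hτ⟩ := exists_isLeast_outcome (f ∘ e.symm)
  have h := isParked_of_isLeast hτ
  refine ⟨τ ∘ e, h.inj.comp e.injective, fun j => by simpa using h.le (e j), fun j s h1 h2 => ?_⟩
  obtain ⟨l, hl⟩ := h.mem_range (e j) s (by simpa using h1) h2
  exact ⟨e.symm l, by simpa using hl⟩

theorem IsParked.lt_of_notMem_range {ι : Type*} {f τ : ι → ℕ} (h : IsParked f τ) {s : ℕ}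
    (hs : s ∉ Set.range τ) {j : ι} (hj : f j ≤ s) : τ j < s := by
  by_contra hlt
  exact hs (h.mem_range j s hj (by omega))

section
variable {ι : Type*} [Fintype ι] {f τ : ι → ℕ}

/-- The maximal occupied run ending at `s` and containing `[x, s]` starts at some `a`; its cars all
prefer spots of the run, since none of them passed the empty spot `a - 1`. -/
theorem IsParked.exists_run (h : IsParked f τ) {x s : ℕ} (hxs : x ≤ s)
    (hx : ∀ t, x ≤ t → t ≤ s → t ∈ Set.range τ) :
    ∃ a ≤ x, s < (Finset.univ.filter fun j => a ≤ f j ∧ f j ≤ s).card + a := by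
  classical
  have hex : ∃ a, a ≤ x ∧ ∀ t, a ≤ t → t ≤ s → t ∈ Set.range τ := ⟨x, le_rfl, hx⟩
  obtain ⟨hax, ha⟩ := Nat.find_spec hex
  set a := Nat.find hex with hadef
  refine ⟨a, hax, ?_⟩
  have hsub : Finset.Icc a s ⊆
      (Finset.univ.filter fun j => a ≤ f j ∧ f j ≤ s).image τ := by
    intro t ht
    rw [Finset.mem_Icc] at ht
    obtain ⟨j, rfl⟩ := ha t ht.1 ht.2
    refine Finset.mem_image.2 ⟨j, Finset.mem_filter.2 ⟨Finset.mem_univ _, ?_, (h.le j).trans ht.2⟩,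
      rfl⟩
    by_contra hlt
    push Not at hlt
    have hnot := Nat.find_min hex (m := a - 1) (by omega)
    refine hnot ⟨by omega, fun t h1 h2 => ?_⟩
    rcases eq_or_ne t (a - 1) with rfl | hne
    · exact h.mem_range j _ (by omega) (by omega)
    · exact ha t (by omega) h2
  have := (Finset.card_le_card hsub).trans Finset.card_image_le
  rw [Nat.card_Icc] at this
  omega

theorem IsParked.vacant_iff (h : IsParked f τ) {s : ℕ} : Vacant f s ↔ s ∉ Set.range τ := by
  classical
  constructor
  · intro hv hs
    obtain ⟨a, ha, hlt⟩ := h.exists_run le_rfl (x := s) (s := s)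
      (fun t h1 h2 => le_antisymm h1 h2 ▸ hs)
    have := hv a ha
    omega
  · intro hs a ha
    have hsub : (Finset.univ.filter fun j => a ≤ f j ∧ f j ≤ s).image τ ⊆ Finset.Ico a s := by
      intro t ht
      obtain ⟨j, hj, rfl⟩ := Finset.mem_image.1 ht
      obtain ⟨-, h1, h2⟩ := Finset.mem_filter.1 hj
      exact Finset.mem_Ico.2 ⟨h1.trans (h.le j), h.lt_of_notMem_range hs h2⟩
    have := Finset.card_le_card hsub
    rw [Finset.card_image_of_injective _ h.inj, Nat.card_Ico] at this
    omega

open scoped Classical in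
/-- Below a vacant spot, the occupied spots are as many as the cars preferring them. -/
theorem Vacant.count_add_card {s : ℕ} (hs : Vacant f s) :
    Nat.count (Vacant f) s + (Finset.univ.filter fun j => f j < s).card = s := by
  obtain ⟨τ, h⟩ := exists_isParked f
  have hs' := h.vacant_iff.1 hs
  have : (Finset.range s).filter (fun t => ¬ Vacant f t) =
      (Finset.univ.filter fun j => f j < s).image τ := by
    ext t
    simp only [Finset.mem_filter, Finset.mem_range, Finset.mem_image, Finset.mem_univ, true_and,
      h.vacant_iff, not_not, Set.mem_range]
    constructor
    · rintro ⟨ht, j, rfl⟩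
      exact ⟨j, (h.le j).trans_lt ht, rfl⟩
    · rintro ⟨j, hj, rfl⟩
      exact ⟨h.lt_of_notMem_range hs' hj.le, j, rfl⟩
  rw [← Finset.card_image_of_injective _ h.inj, ← this, Nat.count_eq_card_filter_range,
    Finset.card_filter_add_card_filter_not, Finset.card_range]

theorem infinite_vacant (f : ι → ℕ) : (Set.ofPred (Vacant f)).Infinite := by
  obtain ⟨τ, h⟩ := exists_isParked f
  have : Set.ofPred (Vacant f) = (Set.range τ)ᶜ := by ext; exact h.vacant_iff
  rw [this]
  exact (Set.finite_range τ).infinite_compl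

theorem Vacant.ne {s : ℕ} (hs : Vacant f s) (j : ι) : f j ≠ s := by
  rintro rfl
  have h := hs _ le_rfl
  have : 0 < (Finset.univ.filter fun l => f j ≤ f l ∧ f l ≤ f j).card :=
    Finset.card_pos.2 ⟨j, by simp⟩
  omega

/-- The `a`-th vacant spot (from `0`) is the vacant spot `s` with `s - a` preferences below it. -/
theorem nth_vacant_eq_iff {a s : ℕ} :
    Nat.nth (Vacant f) a = s ↔
      Vacant f s ∧ (Finset.univ.filter fun j => f j < s).card + a = s := by
  classical
  constructor
  · rintro rfl
    have hv := Nat.nth_mem_of_infinite (infinite_vacant f) a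
    have hc := hv.count_add_card
    rw [Nat.count_nth_of_infinite (infinite_vacant f)] at hc
    exact ⟨hv, by omega⟩
  · rintro ⟨hv, hc⟩
    have : Nat.count (Vacant f) s = a := by have := hv.count_add_card; omega
    rw [← this, Nat.nth_count hv]

end

/-- The parking functions on the spots `0, …, n - 1`, with cars `ι`: in an unbounded row, spot `n`
stays empty. -/
noncomputable def parkFun (ι : Type*) [Fintype ι] [DecidableEq ι] (n : ℕ) : Finset (ι → ℕ) := by
  classical
  exact (Fintype.piFinset fun _ => Finset.range n).filter fun f => Vacant f n

section
variable {ι : Type*} [Fintype ι] [DecidableEq ι] {f : ι → ℕ} {n : ℕ}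

theorem mem_parkFun : f ∈ parkFun ι n ↔ (∀ j, f j < n) ∧ Vacant f n := by
  simp [parkFun]

theorem nth_vacant_lt {a : ℕ} (hf : f ∈ parkFun ι n) (ha : Fintype.card ι + a < n) :
    Nat.nth (Vacant f) a < n := by
  classical
  obtain ⟨h1, h2⟩ := mem_parkFun.1 hf
  have hc := h2.count_add_card
  have : (Finset.univ.filter fun j => f j < n) = Finset.univ := by simp [h1]
  rw [this, Finset.card_univ] at hc
  exact Nat.nth_lt_of_lt_count (by omega)

end

/-! ### Splitting at a vacant spot -/

section
variable {ι : Type*} [Fintype ι] [DecidableEq ι]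

/-- The preferences that follow `f` on the cars in `A` and `g`, moved by `k` spots, elsewhere. -/
def glue (A : Finset ι) (k : ℕ) (f : {x // x ∈ A} → ℕ) (g : {x // x ∉ A} → ℕ) (j : ι) : ℕ :=
  if h : j ∈ A then f ⟨j, h⟩ else g ⟨j, h⟩ + k

omit [Fintype ι] in
theorem glue_mem (A : Finset ι) (k : ℕ) (f : {x // x ∈ A} → ℕ) (g : {x // x ∉ A} → ℕ)
    (j : {x // x ∈ A}) : glue A k f g j = f j := by
  simp [glue]

omit [Fintype ι] in
theorem glue_notMem (A : Finset ι) (k : ℕ) (f : {x // x ∈ A} → ℕ) (g : {x // x ∉ A} → ℕ)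
    (j : {x // x ∉ A}) : glue A k f g j = g j + k := by
  simp [glue, j.2]

theorem card_filter_split (A : Finset ι) (P : ι → Prop) [DecidablePred P] :
    (Finset.univ.filter P).card = (Finset.univ.filter fun j : {x // x ∈ A} => P j).card +
      (Finset.univ.filter fun j : {x // x ∉ A} => P j).card := by
  simp only [Finset.card_filter]
  convert (Fintype.sum_subtype_add_sum_subtype (· ∈ A) fun j => if P j then 1 else 0).symm

/-- If exactly the cars in `A` prefer spots before the vacant spot `s`, these cars and the others
park independently on the two sides of `s`. -/
theorem mem_parkFun_split {A : Finset ι} {s r : ℕ} {h : ι → ℕ} :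
    (h ∈ parkFun ι (s + 1 + r) ∧ Vacant h s ∧ ∀ j, j ∈ A ↔ h j < s) ↔
      ((fun j : {x // x ∈ A} => h j) ∈ parkFun {x // x ∈ A} s ∧
        (fun j : {x // x ∉ A} => h j - (s + 1)) ∈ parkFun {x // x ∉ A} r) ∧ ∀ j ∉ A, s + 1 ≤ h j := by
  simp only [mem_parkFun, Vacant]
  constructor
  · rintro ⟨⟨h1, h2⟩, h3, h4⟩
    have h5 : ∀ j ∉ A, s + 1 ≤ h j := fun j hj => by
      have := Vacant.ne h3 j
      have := mt (h4 j).2 hj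
      omega
    refine ⟨⟨⟨fun j => (h4 j).1 j.2, fun a ha => ?_⟩, fun j => ?_, fun a ha => ?_⟩, h5⟩
    · have := h3 a ha
      rw [card_filter_split A] at this
      omega
    · have := h1 j
      have := h5 j j.2
      omega
    · have := h2 (a + (s + 1)) (by omega)
      rw [card_filter_split A] at this
      have hc : (Finset.univ.filter fun j : {x // x ∉ A} => a + (s + 1) ≤ h j ∧ h j ≤ s + 1 + r) =
          Finset.univ.filter fun j : {x // x ∉ A} => a ≤ h j - (s + 1) ∧ h j - (s + 1) ≤ r := by
        ext j
        have := h5 j j.2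
        simp only [Finset.mem_filter, Finset.mem_univ, true_and]
        omega
      rw [hc] at this
      omega
  · rintro ⟨⟨⟨h1, h2⟩, h3, h4⟩, h5⟩
    refine ⟨⟨fun j => ?_, fun a ha => ?_⟩, fun a ha => ?_, fun j => ⟨fun hj => h1 ⟨j, hj⟩, ?_⟩⟩
    · by_cases hj : j ∈ A
      · have : h j < s := h1 ⟨j, hj⟩
        omega
      · have : h j - (s + 1) < r := h3 ⟨j, hj⟩
        omega
    · rw [card_filter_split A]
      rcases le_or_gt a s with has | has
      · have hA := h2 a has
        have hB := h4 0 (by omega)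
        have hA' : (Finset.univ.filter fun j : {x // x ∈ A} => a ≤ h j ∧ h j ≤ s + 1 + r).card ≤
            (Finset.univ.filter fun j : {x // x ∈ A} => a ≤ h j ∧ h j ≤ s).card :=
          Finset.card_le_card fun j => by
            have := h1 j
            simp only [Finset.mem_filter, Finset.mem_univ, true_and]
            omega
        have hB' : (Finset.univ.filter fun j : {x // x ∉ A} => a ≤ h j ∧ h j ≤ s + 1 + r).card ≤
            (Finset.univ.filter
              fun j : {x // x ∉ A} => 0 ≤ h j - (s + 1) ∧ h j - (s + 1) ≤ r).card :=
          Finset.card_le_card fun j => by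
            simp only [Finset.mem_filter, Finset.mem_univ, true_and]
            omega
        omega
      · have hB := h4 (a - (s + 1)) (by omega)
        have hA' : (Finset.univ.filter fun j : {x // x ∈ A} => a ≤ h j ∧ h j ≤ s + 1 + r).card = 0 :=
          Finset.card_eq_zero.2 <| Finset.filter_eq_empty_iff.2 fun j _ => by
            have := h1 j
            omega
        have hB' : (Finset.univ.filter fun j : {x // x ∉ A} => a ≤ h j ∧ h j ≤ s + 1 + r).card ≤
            (Finset.univ.filter fun j : {x // x ∉ A} =>
              a - (s + 1) ≤ h j - (s + 1) ∧ h j - (s + 1) ≤ r).card :=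
          Finset.card_le_card fun j => by
            simp only [Finset.mem_filter, Finset.mem_univ, true_and]
            omega
        omega
    · rw [card_filter_split A]
      have hB' : (Finset.univ.filter fun j : {x // x ∉ A} => a ≤ h j ∧ h j ≤ s).card = 0 :=
        Finset.card_eq_zero.2 <| Finset.filter_eq_empty_iff.2 fun j _ => by
          have := h5 j j.2
          omega
      have := h2 a ha
      omega
    · intro hj
      by_contra hA
      have := h5 j hA
      omega

/-- Splitting a parking function at its `a`-th vacant spot (from `0`). -/
theorem sum_parkFun_split (a b : ℕ) (w : ℕ → (ι → ℕ) → ℝ) :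
    ∑ f ∈ parkFun ι (Fintype.card ι + a + b + 1), w (Nat.nth (Vacant f) a) f =
      ∑ A : Finset ι, ∑ p ∈ parkFun {x // x ∈ A} (A.card + a) ×ˢ
        parkFun {x // x ∉ A} (Fintype.card ι - A.card + b),
          w (A.card + a) (glue A (A.card + a + 1) p.1 p.2) := by
  rw [← Finset.sum_fiberwise (g := fun f => Finset.univ.filter fun j => f j < Nat.nth (Vacant f) a)]
  refine Finset.sum_congr rfl fun A _ => ?_
  have hcard : Fintype.card ι + a + b + 1 = A.card + a + 1 + (Fintype.card ι - A.card + b) := by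
    have := A.card_le_univ
    omega
  have key : ∀ f : ι → ℕ, (f ∈ (parkFun ι (Fintype.card ι + a + b + 1)).filter
      fun f => (Finset.univ.filter fun j => f j < Nat.nth (Vacant f) a) = A) ↔
      Nat.nth (Vacant f) a = A.card + a ∧
      (f ∈ parkFun ι (A.card + a + 1 + (Fintype.card ι - A.card + b)) ∧ Vacant f (A.card + a) ∧
        ∀ j, j ∈ A ↔ f j < A.card + a) := by
    intro f
    rw [Finset.mem_filter, hcard]
    constructor
    · rintro ⟨h1, h2⟩
      obtain ⟨h3, h4⟩ := nth_vacant_eq_iff.1 (rfl : Nat.nth (Vacant f) a = _)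
      rw [h2] at h4
      refine ⟨h4.symm, h1, h4 ▸ h3, fun j => ?_⟩
      rw [h4]
      nth_rw 1 [← h2]
      simp
    · rintro ⟨h1, h2, h3, h4⟩
      refine ⟨h2, ?_⟩
      rw [h1]
      ext j
      simp [h4]
  refine Finset.sum_bij' (fun f _ => (fun j => f j, fun j => f j - (A.card + a + 1)))
    (fun p _ => glue A (A.card + a + 1) p.1 p.2) ?_ ?_ ?_ ?_ ?_
  · intro f hf
    exact Finset.mem_product.2 (mem_parkFun_split.1 ((key f).1 hf).2).1
  · rintro ⟨g, g'⟩ hp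
    rw [Finset.mem_product] at hp
    refine (key _).2 ?_
    have h := (mem_parkFun_split (A := A) (h := glue A (A.card + a + 1) g g')
      (s := A.card + a) (r := Fintype.card ι - A.card + b)).2
      ⟨⟨by simpa [glue_mem] using hp.1, by simpa [glue_notMem] using hp.2⟩,
        fun j hj => by simp [glue, hj]⟩
    refine ⟨nth_vacant_eq_iff.2 ⟨h.2.1, ?_⟩, h⟩
    congr 2
    ext j
    simp [h.2.2]
  · intro f hf
    have h5 := (mem_parkFun_split.1 ((key f).1 hf).2).2
    funext j
    by_cases hj : j ∈ A
    · simp [glue, hj]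
    · simp [glue, hj, Nat.sub_add_cancel (h5 j hj)]
  · rintro ⟨g, g'⟩ hp
    simp [glue_mem, glue_notMem]
  · intro f hf
    have h5 := (mem_parkFun_split.1 ((key f).1 hf).2).2
    rw [((key f).1 hf).1]
    congr 1
    funext j
    by_cases hj : j ∈ A
    · simp [glue, hj]
    · simp [glue, hj, Nat.sub_add_cancel (h5 j hj)]

end

/-! ### Counts and preference sums -/

section
variable {ι κ : Type*} [Fintype ι] [Fintype κ]

theorem vacant_comp_equiv (e : κ ≃ ι) (f : ι → ℕ) : Vacant (f ∘ e) = Vacant f := by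
  funext s
  refine propext (forall₂_congr fun a _ => ?_)
  rw [← Finset.card_map e.toEmbedding (s := Finset.univ.filter fun j => a ≤ (f ∘ e) j ∧ _)]
  have : (Finset.univ.filter fun j => a ≤ (f ∘ e) j ∧ (f ∘ e) j ≤ s).map e.toEmbedding =
      Finset.univ.filter fun j => a ≤ f j ∧ f j ≤ s := by
    ext j
    simp only [Finset.mem_map_equiv, Finset.mem_filter, Finset.mem_univ, true_and,
      Function.comp_apply, Equiv.apply_symm_apply]
  rw [this]

variable [DecidableEq ι] [DecidableEq κ]

theorem comp_equiv_mem_parkFun (e : κ ≃ ι) {f : ι → ℕ} {n : ℕ} :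
    f ∘ e ∈ parkFun κ n ↔ f ∈ parkFun ι n := by
  rw [mem_parkFun, mem_parkFun, vacant_comp_equiv, ← e.forall_congr_right]
  rfl

theorem sum_parkFun_comp_equiv (e : κ ≃ ι) (n : ℕ) (w : (κ → ℕ) → ℝ) :
    ∑ f ∈ parkFun ι n, w (f ∘ e) = ∑ f ∈ parkFun κ n, w f := by
  refine Finset.sum_nbij' (fun f => f ∘ e) (fun f => f ∘ e.symm)
    (fun f hf => (comp_equiv_mem_parkFun e).2 hf)
    (fun f hf => (comp_equiv_mem_parkFun e.symm).2 hf) ?_ ?_ ?_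
  · intro f _; ext j; simp
  · intro f _; ext j; simp
  · intro f _; rfl

end

/-- The number of parking functions of `m` cars that leave `d - 1` spots vacant. -/
noncomputable def parkCount (m d : ℕ) : ℝ := (parkFun (Fin m) (m + d - 1)).card

/-- The sum of all preferences, counted from `0`, over all cars and over all parking functions of
`m` cars that leave `d - 1` spots vacant. -/
noncomputable def parkSum (m d : ℕ) : ℝ := ∑ f ∈ parkFun (Fin m) (m + d - 1), ∑ j, (f j : ℝ)

section
variable {ι : Type*} [Fintype ι] [DecidableEq ι]

theorem card_parkFun (n m d : ℕ) (hm : Fintype.card ι = m) (hn : n + 1 = m + d) :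
    ((parkFun ι n).card : ℝ) = parkCount m d := by
  have h := sum_parkFun_comp_equiv (Fintype.equivFinOfCardEq hm) n fun _ => 1
  rw [parkCount, ← hn, Nat.add_sub_cancel]
  simpa using h.symm

theorem sum_sum_parkFun (n m d : ℕ) (hm : Fintype.card ι = m) (hn : n + 1 = m + d) :
    ∑ f ∈ parkFun ι n, ∑ j, (f j : ℝ) = parkSum m d := by
  have h := sum_parkFun_comp_equiv (Fintype.equivFinOfCardEq hm) n fun f => ∑ j, (f j : ℝ)
  rw [parkSum, ← hn, Nat.add_sub_cancel, ← h]
  refine Finset.sum_congr rfl fun f _ => ?_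
  exact (Equiv.sum_comp (Fintype.equivFinOfCardEq hm) fun j => (f j : ℝ))

end

/-- The number of parking functions, weighted by a function of the `a`-th vacant spot. -/
theorem sum_nth_vacant (m a b : ℕ) (φ : ℕ → ℝ) :
    ∑ f ∈ parkFun (Fin m) (m + a + b + 1), φ (Nat.nth (Vacant f) a) =
      ∑ s ∈ Finset.range (m + 1), (m.choose s : ℝ) *
        (φ (s + a) * (parkCount s (a + 1) * parkCount (m - s) (b + 1))) := by
  have h := sum_parkFun_split (ι := Fin m) a b fun q _ => φ q
  rw [Fintype.card_fin] at h
  rw [h]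
  have h2 := Finset.sum_powerset_apply_card
    (fun s => φ (s + a) * (parkCount s (a + 1) * parkCount (m - s) (b + 1)))
    (x := (Finset.univ : Finset (Fin m)))
  rw [Finset.powerset_univ, Finset.card_univ, Fintype.card_fin] at h2
  simp only [nsmul_eq_mul] at h2
  rw [← h2]
  refine Finset.sum_congr rfl fun A _ => ?_
  rw [Finset.sum_const, Finset.card_product, nsmul_eq_mul, Nat.cast_mul,
    card_parkFun (A.card + a) A.card (a + 1) (by simp) (by omega),
    card_parkFun (m - A.card + b) (m - A.card) (b + 1) (by simp) (by omega)]
  ring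

/-- The sum of the preferences over all parking functions, weighted by a function of the `a`-th
vacant spot. -/
theorem sum_nth_vacant_mul_sum (m a b : ℕ) (φ : ℕ → ℝ) :
    ∑ f ∈ parkFun (Fin m) (m + a + b + 1), φ (Nat.nth (Vacant f) a) * ∑ j, (f j : ℝ) =
      ∑ s ∈ Finset.range (m + 1), (m.choose s : ℝ) *
        (φ (s + a) * (parkSum s (a + 1) * parkCount (m - s) (b + 1) + parkCount s (a + 1) *
          (parkSum (m - s) (b + 1) + (m - s : ℕ) * (s + a + 1) * parkCount (m - s) (b + 1)))) := by
  have h := sum_parkFun_split (ι := Fin m) a b fun q f => φ q * ∑ j, (f j : ℝ)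
  rw [Fintype.card_fin] at h
  rw [h]
  have h2 := Finset.sum_powerset_apply_card
    (fun s => φ (s + a) * (parkSum s (a + 1) * parkCount (m - s) (b + 1) + parkCount s (a + 1) *
      (parkSum (m - s) (b + 1) + (m - s : ℕ) * (s + a + 1) * parkCount (m - s) (b + 1))))
    (x := (Finset.univ : Finset (Fin m)))
  rw [Finset.powerset_univ, Finset.card_univ, Fintype.card_fin] at h2
  simp only [nsmul_eq_mul] at h2
  rw [← h2]
  refine Finset.sum_congr rfl fun A _ => ?_
  have hA : Fintype.card {x // x ∈ A} = A.card := by simp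
  have hA' : Fintype.card {x // x ∉ A} = m - A.card := by simp
  have hsum : ∀ (g : {x // x ∈ A} → ℕ) (g' : {x // x ∉ A} → ℕ),
      ∑ j, (glue A (A.card + a + 1) g g' j : ℝ) =
        ∑ j, (g j : ℝ) + (∑ j, (g' j : ℝ) + (m - A.card : ℕ) * (A.card + a + 1)) := by
    intro g g'
    rw [← Fintype.sum_subtype_add_sum_subtype (· ∈ A)]
    congr 1
    · simp only [glue_mem]
      congr!
    · simp only [glue_notMem]
      push_cast
      rw [Finset.sum_add_distrib, Finset.sum_const, Finset.card_univ, hA', nsmul_eq_mul]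
  rw [← card_parkFun (A.card + a) A.card (a + 1) hA (by omega),
    ← card_parkFun (m - A.card + b) (m - A.card) (b + 1) hA' (by omega),
    ← sum_sum_parkFun (A.card + a) A.card (a + 1) hA (by omega),
    ← sum_sum_parkFun (m - A.card + b) (m - A.card) (b + 1) hA' (by omega),
    ← Finset.mul_sum, Finset.sum_product]
  simp only [hsum, Finset.sum_add_distrib, Finset.sum_const, nsmul_eq_mul, ← Finset.mul_sum]
  ring

/-- One more car can be parked exactly if it prefers a spot up to the last vacant one. -/
theorem cons_mem_parkFun {m b x : ℕ} {f : Fin m → ℕ} :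
    (Fin.cons x f : Fin (m + 1) → ℕ) ∈ parkFun (Fin (m + 1)) (m + b + 1) ↔
      f ∈ parkFun (Fin m) (m + b + 1) ∧ x ≤ Nat.nth (Vacant f) b := by
  classical
  have hcard : ∀ a s, (Finset.univ.filter fun j : Fin (m + 1) =>
      a ≤ (Fin.cons x f : Fin (m + 1) → ℕ) j ∧ (Fin.cons x f : Fin (m + 1) → ℕ) j ≤ s).card =
      (if a ≤ x ∧ x ≤ s then 1 else 0) + (Finset.univ.filter fun j => a ≤ f j ∧ f j ≤ s).card := by
    intro a s
    simp only [Finset.card_filter, Fin.sum_univ_succ, Fin.cons_zero, Fin.cons_succ]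
  simp only [mem_parkFun, Vacant, hcard, Fin.forall_fin_succ, Fin.cons_zero, Fin.cons_succ]
  obtain ⟨τ, hτ⟩ := exists_isParked f
  constructor
  · rintro ⟨⟨h1, h2⟩, h3⟩
    have hv : Vacant f (m + b + 1) := fun a ha => by have := h3 a ha; omega
    refine ⟨⟨h2, hv⟩, ?_⟩
    by_contra hx
    push Not at hx
    have hc := hv.count_add_card
    have hall : (Finset.univ.filter fun j => f j < m + b + 1) = Finset.univ := by simp [h2]
    rw [hall, Finset.card_univ, Fintype.card_fin] at hc
    obtain ⟨a, ha, hlt⟩ := hτ.exists_run (x := x) (s := m + b) (by omega) fun t h4 h5 => by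
      by_contra ht
      have ht' := hτ.vacant_iff.2 ht
      have h6 : Nat.count (Vacant f) t < b + 1 := by
        have := Nat.count_strict_mono ht' (show t < m + b + 1 by omega)
        omega
      have h7 := Nat.nth_monotone (infinite_vacant f) (show Nat.count (Vacant f) t ≤ b by omega)
      rw [Nat.nth_count ht'] at h7
      omega
    have h4 := h3 a (by omega)
    rw [if_pos ⟨ha, by omega⟩] at h4
    have h5 : (Finset.univ.filter fun j => a ≤ f j ∧ f j ≤ m + b).card ≤
        (Finset.univ.filter fun j => a ≤ f j ∧ f j ≤ m + b + 1).card :=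
      Finset.card_le_card fun j => by
        simp only [Finset.mem_filter, Finset.mem_univ, true_and]
        omega
    omega
  · rintro ⟨⟨h1, h2⟩, hx⟩
    have hs : Nat.nth (Vacant f) b < m + b + 1 :=
      nth_vacant_lt (mem_parkFun.2 ⟨h1, h2⟩) (by simp)
    have hv := Nat.nth_mem_of_infinite (infinite_vacant f) b
    set s := Nat.nth (Vacant f) b
    refine ⟨⟨by omega, h1⟩, fun a ha => ?_⟩
    have h4 := h2 a ha
    split_ifs with hax
    · have h5 := hv a (by omega)
      have h6 := h2 (s + 1) (by omega)
      have h7 : (Finset.univ.filter fun j => a ≤ f j ∧ f j ≤ m + b + 1).card ≤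
          ((Finset.univ.filter fun j => a ≤ f j ∧ f j ≤ s) ∪
          (Finset.univ.filter fun j => s + 1 ≤ f j ∧ f j ≤ m + b + 1)).card :=
        Finset.card_le_card fun j => by
          simp only [Finset.mem_filter, Finset.mem_univ, true_and, Finset.mem_union]
          omega
      have h8 := h7.trans (Finset.card_union_le _ _)
      omega
    · omega

/-- The first car of a parking function can be removed and given back any preference up to the last
vacant spot; the count does not depend on the order of the cars. -/
theorem parkCount_succ (m b : ℕ) :
    parkCount (m + 1) (b + 1) =
      ∑ f ∈ parkFun (Fin m) (m + b + 1), ((Nat.nth (Vacant f) b + 1 : ℕ) : ℝ) := by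
  rw [parkCount, ← Nat.cast_sum]
  congr 1
  have h : ∀ f : Fin m → ℕ, Nat.nth (Vacant f) b + 1 =
      (Finset.range (Nat.nth (Vacant f) b + 1)).card := fun f => (Finset.card_range _).symm
  rw [Finset.sum_congr rfl fun f _ => h f, ← Finset.card_sigma]
  refine Finset.card_nbij' (fun f => ⟨Fin.tail f, f 0⟩) (fun p => Fin.cons p.2 p.1) ?_ ?_ ?_ ?_
  · intro f hf
    rw [← Fin.cons_self_tail f, Finset.mem_coe, show m + 1 + (b + 1) - 1 = m + b + 1 by omega,
      cons_mem_parkFun] at hf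
    simpa [Nat.lt_succ_iff] using hf
  · intro p hp
    rw [Finset.mem_coe, show m + 1 + (b + 1) - 1 = m + b + 1 by omega, cons_mem_parkFun]
    simpa [Nat.lt_succ_iff] using hp
  · intro f _; simp
  · intro p _; simp

theorem parkCount_zero (b : ℕ) : parkCount 0 (b + 1) = 1 := by
  have : parkFun (Fin 0) (0 + (b + 1) - 1) = Finset.univ := by
    ext f
    simp [mem_parkFun, Vacant, -Finset.univ_unique]
  rw [parkCount, this]
  simp

/-! ### Generating functions and the number of parking functions -/

section
open scoped PowerSeries Nat

/-- The exponential generating function of a sequence. -/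
noncomputable def egf (u : ℕ → ℝ) : ℝ⟦X⟧ := PowerSeries.mk fun m => u m / m !

theorem egf_injective : Function.Injective egf := by
  intro u v h
  funext m
  have := congrArg (PowerSeries.coeff m) h
  simp only [egf, PowerSeries.coeff_mk] at this
  exact (div_left_inj' (by positivity)).1 this

theorem egf_add (u v : ℕ → ℝ) : egf u + egf v = egf fun m => u m + v m := by
  ext m
  simp [egf, add_div]

theorem natCast_mul_egf (k : ℕ) (u : ℕ → ℝ) : (k : ℝ⟦X⟧) * egf u = egf fun m => k * u m := by
  ext m
  rw [← nsmul_eq_mul, map_nsmul]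
  simp [egf, mul_div_assoc]

theorem egf_mul (u v : ℕ → ℝ) :
    egf u * egf v = egf fun m => ∑ s ∈ Finset.range (m + 1), m.choose s * (u s * v (m - s)) := by
  ext m
  rw [PowerSeries.coeff_mul, Finset.Nat.sum_antidiagonal_eq_sum_range_succ_mk]
  simp only [egf, PowerSeries.coeff_mk, Finset.sum_div]
  refine Finset.sum_congr rfl fun s hs => ?_
  rw [Nat.cast_choose ℝ (by simpa [Nat.lt_succ_iff] using hs)]
  have : (m ! : ℝ) ≠ 0 := by positivity
  field_simp

/-- The derivation `X d/dX`, which multiplies the `m`-th coefficient by `m`. -/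
noncomputable def eulerDer : Derivation ℝ ℝ⟦X⟧ ℝ⟦X⟧ :=
  (PowerSeries.X : ℝ⟦X⟧) • PowerSeries.derivative ℝ

theorem eulerDer_egf (u : ℕ → ℝ) : eulerDer (egf u) = egf fun m => m * u m := by
  ext m
  rw [eulerDer, Derivation.smul_apply, smul_eq_mul]
  cases m with
  | zero => simp [egf]
  | succ m =>
    rw [PowerSeries.coeff_succ_X_mul, PowerSeries.coeff_derivative]
    simp [egf]
    ring

/-- The exponential generating function of the classical parking functions, with one car per
spot. -/
noncomputable def parkSeries : ℝ⟦X⟧ := egf fun m => parkCount m 1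

/-- The logarithmic derivative `X F' / F` of the series `F` of classical parking functions. -/
noncomputable def parkLog : ℝ⟦X⟧ := eulerDer parkSeries * parkSeries⁻¹

theorem parkSeries_mul_inv : parkSeries * parkSeries⁻¹ = 1 := by
  refine PowerSeries.mul_inv_cancel _ ?_
  simp [parkSeries, egf, parkCount_zero 0]

theorem eulerDer_parkSeries : eulerDer parkSeries = parkSeries * parkLog := by
  rw [parkLog, mul_left_comm, parkSeries_mul_inv, mul_one]

theorem eulerDer_parkSeries_pow (k : ℕ) :
    eulerDer (parkSeries ^ k) = k * parkSeries ^ k * parkLog := by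
  rw [Derivation.leibniz_pow, eulerDer_parkSeries]
  cases k with
  | zero => simp
  | succ k =>
    simp only [Nat.add_sub_cancel, smul_eq_mul, nsmul_eq_mul]
    ring

/-- Cutting at a vacant spot turns into a product of generating functions. -/
theorem egf_parkCount_add (a b : ℕ) :
    (egf fun m => parkCount m (a + b + 2)) =
      (egf fun m => parkCount m (a + 1)) * egf fun m => parkCount m (b + 1) := by
  rw [egf_mul]
  congr 1
  funext m
  have h := sum_nth_vacant m a b fun _ => 1
  simp only [Finset.sum_const, nsmul_eq_mul, mul_one, one_mul] at h
  rw [← h, parkCount]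
  congr 3
  omega

theorem egf_parkCount (d : ℕ) : (egf fun m => parkCount m (d + 1)) = parkSeries ^ (d + 1) := by
  induction d with
  | zero => simp [parkSeries]
  | succ d ih =>
    have := egf_parkCount_add d 0
    rw [ih] at this
    rw [pow_succ]
    exact this

/-- The `(a+1)`-st vacant spot number has mean `(a+1)/d` times the total number `m + d` of spots,
the unused one after the row included, where `d = a + b + 2`. -/
theorem sum_nth_vacant_add_one (m a b : ℕ) :
    (a + b + 2 : ℕ) * ∑ f ∈ parkFun (Fin m) (m + a + b + 1), ((Nat.nth (Vacant f) a : ℝ) + 1) =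
      (a + 1 : ℕ) * ((m + (a + b + 2 : ℕ)) * parkCount m (a + b + 2)) := by
  revert m
  rw [← funext_iff]
  apply egf_injective
  have h1 : (egf fun m => ∑ f ∈ parkFun (Fin m) (m + a + b + 1), ((Nat.nth (Vacant f) a : ℝ) + 1)) =
      (eulerDer (parkSeries ^ (a + 1)) + (a + 1 : ℕ) * parkSeries ^ (a + 1)) *
        parkSeries ^ (b + 1) := by
    rw [← egf_parkCount a, ← egf_parkCount b, eulerDer_egf, natCast_mul_egf, egf_add, egf_mul]
    congr 1
    funext m
    rw [sum_nth_vacant m a b fun q => (q : ℝ) + 1]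
    refine Finset.sum_congr rfl fun s _ => ?_
    push_cast
    ring
  have h2 : (egf fun m => ((m : ℝ) + (a + b + 2 : ℕ)) * parkCount m (a + b + 2)) =
      eulerDer (parkSeries ^ (a + b + 2)) + (a + b + 2 : ℕ) * parkSeries ^ (a + b + 2) := by
    rw [← egf_parkCount (a + b + 1), eulerDer_egf, natCast_mul_egf, egf_add]
    congr 1
    funext m
    ring
  rw [← natCast_mul_egf, ← natCast_mul_egf, h1, h2]
  simp only [eulerDer_parkSeries_pow]
  push_cast
  ring

/-- The number of parking functions of `m` cars on `n` spots is `d (n + 1) ^ (m - 1)`, where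
`n + 1 = m + d`. -/
theorem parkCount_eq (m b : ℕ) :
    (m + (b + 1 : ℕ)) * parkCount m (b + 1) = (b + 1 : ℕ) * ((m : ℝ) + (b + 1 : ℕ)) ^ m := by
  induction m generalizing b with
  | zero => simp [parkCount_zero]
  | succ m ih =>
    have h1 := parkCount_succ m b
    have h2 := sum_nth_vacant_add_one m b 0
    have h3 : ((m : ℝ) + (b + 2 : ℕ)) * parkCount m (b + 2) = (b + 2 : ℕ) * (m + (b + 2 : ℕ)) ^ m :=
      ih (b + 1)
    push_cast at h1 h2 h3 ⊢
    simp only [add_zero] at h1 h2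
    rw [← h1, h3] at h2
    have : (b : ℝ) + 2 ≠ 0 := by positivity
    refine mul_left_cancel₀ this ?_
    rw [show (m : ℝ) + 1 + (b + 1) = m + (b + 2) by ring]
    linear_combination ((m : ℝ) + (b + 2)) * h2

/-! ### Preference sums and their correlation with a vacant spot -/

/-- The generating function of the preference sums, with `d + 1` blocks. Besides the part with the
unknown series for one block, which is symmetric in the blocks, each of the `d (d + 1) / 2` pairs of
blocks contributes the product of the length of the first one with the number of cars in the second
one. -/
theorem two_mul_egf_parkSum (d : ℕ) :
    2 * (egf fun m => parkSum m (d + 1)) = parkSeries ^ (d + 1) *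
      ((d + 1 : ℕ) * (2 * ((egf fun m => parkSum m 1) * parkSeries⁻¹)) +
        (d + 1 : ℕ) * d * (parkLog * (1 + parkLog))) := by
  induction d with
  | zero =>
    simp only [zero_add, pow_one, Nat.cast_one, Nat.cast_zero]
    linear_combination (-2 * (egf fun m => parkSum m 1)) * parkSeries_mul_inv
  | succ d ih =>
    have h : (egf fun m => parkSum m (d + 1 + 1)) =
        (egf fun m => parkSum m 1) * parkSeries ^ (d + 1) +
          (parkSeries * (egf fun m => parkSum m (d + 1)) +
            (eulerDer parkSeries + parkSeries) * eulerDer (parkSeries ^ (d + 1))) := by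
      rw [← egf_parkCount d, parkSeries, eulerDer_egf, eulerDer_egf, egf_add, egf_mul, egf_mul,
        egf_mul, egf_add, egf_add]
      congr 1
      funext m
      have h := sum_nth_vacant_mul_sum m 0 d fun _ => 1
      simp only [one_mul] at h
      rw [parkSum, show m + (d + 1 + 1) - 1 = m + 0 + d + 1 by omega, h,
        ← Finset.sum_add_distrib, ← Finset.sum_add_distrib]
      refine Finset.sum_congr rfl fun s _ => ?_
      push_cast
      ring
    rw [h, eulerDer_parkSeries, eulerDer_parkSeries_pow]
    push_cast at ih ⊢
    linear_combination parkSeries * ih -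
      2 * (egf fun m => parkSum m 1) * parkSeries ^ (d + 1) * parkSeries_mul_inv

/-- The covariance of the preference sum with the `(a+1)`-st vacant spot, up to normalization, in
terms of the second moment of the first vacant spot. The unknown preference sums of classical parking
functions enter only through the mean. -/
theorem sum_nth_vacant_mul_sum_sub (m a b : ℕ) :
    2 * (a + b + 1 : ℕ) * ((a + b + 2 : ℕ) * ∑ f ∈ parkFun (Fin m) (m + a + b + 1),
          ((Nat.nth (Vacant f) a : ℝ) + 1) * ∑ j, (f j : ℝ) -
        (a + 1 : ℕ) * ((m + (a + b + 2 : ℕ)) * parkSum m (a + b + 2))) =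
      (a + 1 : ℕ) * (b + 1 : ℕ) * ((m + (a + b + 2 : ℕ)) ^ 2 * parkCount m (a + b + 2) -
        (a + b + 2 : ℕ) ^ 2 * ∑ s ∈ Finset.range (m + 1), (m.choose s : ℝ) *
          ((s + 1) ^ 2 * parkCount s 1 * parkCount (m - s) (a + b + 1))) := by
  set Q : ℕ → ℝ := fun m => ∑ f ∈ parkFun (Fin m) (m + a + b + 1),
          ((Nat.nth (Vacant f) a : ℝ) + 1) * ∑ j, (f j : ℝ) with hQ
  set B : ℕ → ℝ := fun m => ∑ s ∈ Finset.range (m + 1), (m.choose s : ℝ) *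
          ((s + 1) ^ 2 * parkCount s 1 * parkCount (m - s) (a + b + 1)) with hB
  set σ := (egf fun m => parkSum m 1) * parkSeries⁻¹ with hσ
  have hQ' : egf Q =
      (eulerDer (egf fun m => parkSum m (a + 1)) + (a + 1 : ℕ) * egf fun m => parkSum m (a + 1)) *
        parkSeries ^ (b + 1) +
      ((eulerDer (parkSeries ^ (a + 1)) + (a + 1 : ℕ) * parkSeries ^ (a + 1)) *
        (egf fun m => parkSum m (b + 1)) +
      (eulerDer (eulerDer (parkSeries ^ (a + 1)) + (a + 1 : ℕ) * parkSeries ^ (a + 1)) +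
        (a + 1 : ℕ) * (eulerDer (parkSeries ^ (a + 1)) + (a + 1 : ℕ) * parkSeries ^ (a + 1))) *
          eulerDer (parkSeries ^ (b + 1))) := by
    rw [← egf_parkCount a, ← egf_parkCount b]
    simp only [eulerDer_egf, natCast_mul_egf, egf_add, egf_mul]
    congr 1
    funext m
    refine (sum_nth_vacant_mul_sum m a b fun q => (q : ℝ) + 1).trans ?_
    rw [← Finset.sum_add_distrib, ← Finset.sum_add_distrib]
    refine Finset.sum_congr rfl fun s _ => ?_
    push_cast
    ring
  have hS : (egf fun m => ((m : ℝ) + (a + b + 2 : ℕ)) * parkSum m (a + b + 2)) =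
      eulerDer (egf fun m => parkSum m (a + b + 2)) +
        (a + b + 2 : ℕ) * egf fun m => parkSum m (a + b + 2) := by
    rw [eulerDer_egf, natCast_mul_egf, egf_add]
    congr 1
    funext m
    ring
  have hB' : egf B = (eulerDer (eulerDer parkSeries + parkSeries) +
      (eulerDer parkSeries + parkSeries)) * parkSeries ^ (a + b + 1) := by
    rw [← egf_parkCount, parkSeries]
    simp only [eulerDer_egf, egf_add, egf_mul]
    congr 1
    funext m
    refine Finset.sum_congr rfl fun s _ => ?_
    ring
  have hP : (egf fun m => ((m : ℝ) + (a + b + 2 : ℕ)) ^ 2 * parkCount m (a + b + 2)) =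
      eulerDer (eulerDer (parkSeries ^ (a + b + 2)) +
        (a + b + 2 : ℕ) * parkSeries ^ (a + b + 2)) + (a + b + 2 : ℕ) *
        (eulerDer (parkSeries ^ (a + b + 2)) + (a + b + 2 : ℕ) * parkSeries ^ (a + b + 2)) := by
    rw [← egf_parkCount (a + b + 1)]
    simp only [eulerDer_egf, natCast_mul_egf, egf_add]
    congr 1
    funext m
    ring
  -- The Euler derivation of the formula for the preference sums.
  have hder : ∀ d : ℕ, 2 * eulerDer (egf fun m => parkSum m (d + 1)) = parkSeries ^ (d + 1) *
      ((d + 1 : ℕ) * parkLog * ((d + 1 : ℕ) * (2 * σ) +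
        (d + 1 : ℕ) * d * (parkLog * (1 + parkLog))) + ((d + 1 : ℕ) * (2 * eulerDer σ) +
        (d + 1 : ℕ) * d * (eulerDer parkLog * (1 + 2 * parkLog)))) := by
    intro d
    have h := congrArg eulerDer (two_mul_egf_parkSum d)
    have h2 : eulerDer (2 : ℝ⟦X⟧) = 0 := by exact_mod_cast eulerDer.map_natCast 2
    simp only [Derivation.leibniz, eulerDer_parkSeries_pow, map_add, ← hσ, smul_eq_mul,
      Derivation.map_natCast, h2, Derivation.map_one_eq_zero] at h
    linear_combination h
  -- With `F' = F y` for the Euler derivation, both sides become polynomials in `F`, `y`, `σ` and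
  -- their derivatives; subtractions are moved across, as coefficients are compared below.
  have key : 2 * ((a + b + 1 : ℕ) : ℝ⟦X⟧) * ((a + b + 2 : ℕ) * egf Q) +
      ((a + 1 : ℕ) * (b + 1 : ℕ)) * ((a + b + 2 : ℕ) ^ 2 * egf B) =
      2 * ((a + b + 1 : ℕ) : ℝ⟦X⟧) * ((a + 1 : ℕ) *
        egf fun m => ((m : ℝ) + (a + b + 2 : ℕ)) * parkSum m (a + b + 2)) +
      ((a + 1 : ℕ) * (b + 1 : ℕ)) *
        egf fun m => ((m : ℝ) + (a + b + 2 : ℕ)) ^ 2 * parkCount m (a + b + 2) := by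
    rw [hQ', hS, hB', hP]
    simp only [eulerDer_parkSeries_pow, eulerDer_parkSeries, map_add, Derivation.leibniz,
      smul_eq_mul, Derivation.map_natCast]
    have h1 := two_mul_egf_parkSum a
    have h2 := two_mul_egf_parkSum b
    have h3 := two_mul_egf_parkSum (a + b + 1)
    have h4 := hder a
    have h6 := hder (a + b + 1)
    rw [← hσ] at h1 h2 h3
    push_cast at h1 h2 h3 h4 h6 ⊢
    linear_combination ((a : ℝ⟦X⟧) + b + 1) * (a + b + 2) * (parkSeries ^ (b + 1) * h4 +
      (a + 1) * parkSeries ^ (b + 1) * h1 + (a + 1) * (parkLog + 1) * parkSeries ^ (a + 1) * h2) -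
      ((a : ℝ⟦X⟧) + b + 1) * (a + 1) * (h6 + (a + b + 2) * h3)
  have h := egf_injective (by
    simpa only [← Nat.cast_ofNat (R := ℝ⟦X⟧) (n := 2), ← Nat.cast_mul, ← Nat.cast_pow,
      natCast_mul_egf, egf_add] using key)
  have := congrFun h m
  push_cast at this ⊢
  linear_combination this

end

/-! ### The second moment of the first vacant spot -/

/-- Abel's binomial identity: after multiplication by `a + 1`, both sides are the sum of the `(a+1)`-st
vacant spot number over all parking functions. -/
theorem sum_choose_mul_pow_mul_parkCount (m a b : ℕ) :
    ∑ s ∈ Finset.range (m + 1), (m.choose s : ℝ) *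
      (((s : ℝ) + (a + 1 : ℕ)) ^ s * parkCount (m - s) (b + 1)) =
        ((m : ℝ) + (a + b + 2 : ℕ)) ^ m := by
  have h1 := sum_nth_vacant_add_one m a b
  have h2 : ((m : ℝ) + (a + b + 2 : ℕ)) * parkCount m (a + b + 2) =
    (a + b + 2 : ℕ) * ((m : ℝ) + (a + b + 2 : ℕ)) ^ m := parkCount_eq m (a + b + 1)
  have h3 : ∑ f ∈ parkFun (Fin m) (m + a + b + 1), ((Nat.nth (Vacant f) a : ℝ) + 1) =
      (a + 1 : ℕ) * ∑ s ∈ Finset.range (m + 1), (m.choose s : ℝ) *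
      (((s : ℝ) + (a + 1 : ℕ)) ^ s * parkCount (m - s) (b + 1)) := by
    rw [sum_nth_vacant m a b fun q => (q : ℝ) + 1, Finset.mul_sum]
    refine Finset.sum_congr rfl fun s _ => ?_
    have h := parkCount_eq s a
    push_cast at h ⊢
    linear_combination ((m.choose s : ℝ) * parkCount (m - s) (b + 1)) * h
  rw [h2, h3] at h1
  have h4 : ((a + 1 : ℕ) : ℝ) ≠ 0 := by positivity
  have h5 : ((a + b + 2 : ℕ) : ℝ) ≠ 0 := by positivity
  refine mul_left_cancel₀ h5 (mul_left_cancel₀ h4 ?_)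
  linear_combination h1

/-- Abel's sum with the exponent raised by one. Expanding one factor `s + x`, with `x = a + 1`, gives
`x` times Abel's sum and a term with a factor `s`; absorbing this factor into the binomial
coefficient leads to the same sum for `m - 1` and `x + 1`, where `m + x + b + 1` is unchanged. -/
theorem sum_choose_mul_pow_succ_mul_parkCount (m a b : ℕ) :
    ∑ s ∈ Finset.range (m + 1), (m.choose s : ℝ) *
      (((s : ℝ) + (a + 1 : ℕ)) ^ (s + 1) * parkCount (m - s) (b + 1)) =
      ∑ k ∈ Finset.range (m + 1), (m.descFactorial k : ℝ) * ((a + 1 + k : ℕ) *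
        ((m : ℝ) + (a + b + 2 : ℕ)) ^ (m - k)) := by
  induction m generalizing a with
  | zero => simp [parkCount_zero]
  | succ m ih =>
    have h1 : ∀ s : ℕ, ((m + 1).choose s : ℝ) *
        (((s : ℝ) + (a + 1 : ℕ)) ^ (s + 1) * parkCount (m + 1 - s) (b + 1)) =
        (a + 1 : ℕ) * (((m + 1).choose s : ℝ) * (((s : ℝ) + (a + 1 : ℕ)) ^ s *
          parkCount (m + 1 - s) (b + 1))) + ((m + 1).choose s * s : ℝ) *
          (((s : ℝ) + (a + 1 : ℕ)) ^ s * parkCount (m + 1 - s) (b + 1)) := by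
      intro s
      ring
    have h2 : ∀ s : ℕ, ((m + 1).choose (s + 1) * (s + 1 : ℕ) : ℝ) = (m + 1) * m.choose s := by
      intro s
      exact_mod_cast (Nat.add_one_mul_choose_eq m s).symm
    rw [Finset.sum_congr rfl fun s _ => h1 s, Finset.sum_add_distrib, ← Finset.mul_sum,
      sum_choose_mul_pow_mul_parkCount, Finset.sum_range_succ']
    simp only [h2]
    have h3 := ih (a + 1)
    rw [Finset.sum_range_succ' _ (m + 1)]
    simp only [Nat.succ_descFactorial_succ, Nat.add_sub_add_right]
    have h4 : ∀ s ∈ Finset.range (m + 1), ((m : ℝ) + 1) * m.choose s *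
        ((((s + 1 : ℕ) : ℝ) + (a + 1 : ℕ)) ^ (s + 1) * parkCount (m - s) (b + 1)) =
        (m + 1) * ((m.choose s : ℝ) *
          (((s : ℝ) + (a + 1 + 1 : ℕ)) ^ (s + 1) * parkCount (m - s) (b + 1))) := by
      intro s _
      rw [show (((s + 1 : ℕ) : ℝ) + (a + 1 : ℕ)) = s + (a + 1 + 1 : ℕ) by push_cast; ring]
      ring
    rw [Finset.sum_congr rfl h4, ← Finset.mul_sum, h3, Finset.mul_sum]
    have h5 : ∀ k ∈ Finset.range (m + 1), ((m : ℝ) + 1) * ((m.descFactorial k : ℝ) *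
        ((a + 1 + 1 + k : ℕ) * ((m : ℝ) + (a + 1 + b + 2 : ℕ)) ^ (m - k))) =
        (((m + 1) * m.descFactorial k : ℕ) : ℝ) * ((a + 1 + (k + 1) : ℕ) *
          (((m + 1 : ℕ) : ℝ) + (a + b + 2 : ℕ)) ^ (m - k)) := by
      intro k _
      rw [show ((m : ℝ) + (a + 1 + b + 2 : ℕ)) = ((m + 1 : ℕ) : ℝ) + (a + b + 2 : ℕ) by
        push_cast; ring]
      push_cast
      ring
    rw [Finset.sum_congr rfl h5]
    simp
    ring

/-- The sum `∑ k, (k + 1) m (m - 1) ⋯ (m - k + 1) / M ^ k` over `k ≤ m`, which is `d / M` times the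
second moment of the first vacant spot number when `M = m + d`. -/
noncomputable def momentSum (m M : ℕ) : ℝ :=
  ∑ k ∈ Finset.range (m + 1), ((k : ℝ) + 1) * ((m.descFactorial k : ℝ) / (M : ℝ) ^ k)

/-- The sum of the squared first vacant spot number over the parking functions of `m` cars that leave
`b + 1` spots vacant. -/
theorem sum_sq_first_vacant (m b : ℕ) :
    (b + 2 : ℕ) * ∑ s ∈ Finset.range (m + 1), (m.choose s : ℝ) *
      ((s + 1) ^ 2 * parkCount s 1 * parkCount (m - s) (b + 1)) =
      (m + (b + 2 : ℕ)) * parkCount m (b + 2) * momentSum m (m + (b + 2)) := by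
  have h1 := sum_choose_mul_pow_succ_mul_parkCount m 0 b
  have h2 : ((m : ℝ) + (b + 2 : ℕ)) * parkCount m (b + 2) =
    (b + 2 : ℕ) * ((m : ℝ) + (b + 2 : ℕ)) ^ m := parkCount_eq m (b + 1)
  rw [h2, mul_assoc]
  congr 1
  rw [momentSum, Finset.mul_sum]
  refine Eq.trans (Finset.sum_congr rfl fun s _ => ?_) (h1.trans
    (Finset.sum_congr rfl fun k hk => ?_))
  · have h := parkCount_eq s 0
    push_cast at h ⊢
    linear_combination ((m.choose s : ℝ) * (s + 1) * parkCount (m - s) (b + 1)) * h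
  · have hkm : k ≤ m := by simpa [Nat.lt_succ_iff] using hk
    have hM : ((m : ℝ) + (b + 2 : ℕ)) ≠ 0 := by positivity
    rw [pow_sub₀ _ (by push_cast at hM ⊢; simpa using hM) hkm]
    push_cast at hM ⊢
    field_simp
    ring

/-! ### Asymptotics of the second moment -/

theorem descFactorial_div_pow_le (m M k : ℕ) :
    (m.descFactorial k : ℝ) / (M : ℝ) ^ k ≤ ((m : ℝ) / M) ^ k := by
  rw [div_pow]
  gcongr
  exact_mod_cast Nat.descFactorial_le_pow m k

theorem tendsto_descFactorial_div_pow {m M : ℕ → ℕ} {c : ℝ} (hM : Tendsto M atTop atTop)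
    (hmM : Tendsto (fun N => (m N : ℝ) / M N) atTop (𝓝 c)) (hm : Tendsto m atTop atTop) (k : ℕ) :
    Tendsto (fun N => ((m N).descFactorial k : ℝ) / (M N : ℝ) ^ k) atTop (𝓝 (c ^ k)) := by
  induction k with
  | zero => simp
  | succ k ih =>
    have h0 : Tendsto (fun N => (k : ℝ) / M N) atTop (𝓝 0) :=
      (tendsto_natCast_atTop_atTop.comp hM).const_div_atTop _
    have h := (hmM.sub h0).mul ih
    rw [sub_zero, ← pow_succ'] at h
    refine h.congr' ?_
    filter_upwards [hm.eventually_ge_atTop k] with N hN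
    rw [Nat.descFactorial_succ, Nat.cast_mul, Nat.cast_sub hN, pow_succ', ← sub_div,
      div_mul_div_comm]

theorem tendsto_momentSum {m M : ℕ → ℕ} {c : ℝ} (hc0 : 0 < c) (hc1 : c < 1)
    (hM : Tendsto M atTop atTop)
    (hmM : Tendsto (fun N => (m N : ℝ) / M N) atTop (𝓝 c)) (hm : Tendsto m atTop atTop) :
    Tendsto (fun N => momentSum (m N) (M N)) atTop (𝓝 (1 / (1 - c) ^ 2)) := by
  obtain ⟨r, hcr, hr1⟩ := exists_between hc1
  have hr0 : 0 < r := hc0.trans hcr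
  have hsum : ∀ x : ℝ, 0 < x → x < 1 →
      HasSum (fun k : ℕ => ((k : ℝ) + 1) * x ^ k) (1 / (1 - x) ^ 2) := by
    intro x h0 h1
    have hx : ‖x‖ < 1 := by rwa [Real.norm_of_nonneg h0.le]
    have h := (hasSum_coe_mul_geometric_of_norm_lt_one hx).add (hasSum_geometric_of_norm_lt_one hx)
    have h2 : x / (1 - x) ^ 2 + (1 - x)⁻¹ = 1 / (1 - x) ^ 2 := by
      have : 1 - x ≠ 0 := by linarith
      field_simp
      ring
    rw [h2] at h
    simpa only [add_mul, one_mul] using h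
  have hlim := tendsto_tsum_of_dominated_convergence (𝓕 := atTop)
    (f := fun N (k : ℕ) => ((k : ℝ) + 1) * (((m N).descFactorial k : ℝ) / (M N : ℝ) ^ k))
    (g := fun (k : ℕ) => ((k : ℝ) + 1) * c ^ k) (hsum r hr0 hr1).summable
    (fun k => (tendsto_descFactorial_div_pow hM hmM hm k).const_mul _) ?_
  · rw [(hsum c hc0 hc1).tsum_eq] at hlim
    refine hlim.congr fun N => ?_
    refine tsum_eq_sum fun k hk => ?_
    rw [Nat.descFactorial_eq_zero_iff_lt.2 (by simpa using hk)]
    simp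
  · filter_upwards [hmM.eventually_lt_const hcr] with N hN k
    rw [Real.norm_of_nonneg (by positivity)]
    refine mul_le_mul_of_nonneg_left ?_ (by positivity)
    exact (descFactorial_div_pow_le _ _ _).trans
      (pow_le_pow_left₀ (by positivity) hN.le k)

/-! ### Parking outcomes and vacant spots -/

section
variable {m n : ℕ} {π τ : Fin m → Fin n}

theorem IsParkingOutcome.isParked (h : IsParkingOutcome π τ) :
    IsParked (fun j => (π j : ℕ)) (fun j => (τ j : ℕ)) := by
  refine isParked_of_isLeast fun j => ⟨⟨(h j).1.1, fun l hl => ?_⟩, ?_⟩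
  · exact Fin.val_injective.ne ((h j).1.2 l hl)
  · rintro s ⟨h1, h2⟩
    rcases lt_or_ge s n with hs | hs
    · have h4 : τ j ≤ ⟨s, hs⟩ := (h j).2 ⟨h1, fun l hl h3 => h2 l hl (congrArg Fin.val h3)⟩
      exact h4
    · exact (τ j).2.le.trans hs

theorem mem_parkingFunctions_iff :
    π ∈ parkingFunctions m n ↔ (fun j => (π j : ℕ)) ∈ parkFun (Fin m) n := by
  rw [mem_parkFun]
  constructor
  · rintro ⟨τ, hτ⟩
    refine ⟨fun j => (π j).2, hτ.isParked.vacant_iff.2 ?_⟩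
    rintro ⟨j, hj⟩
    exact (τ j).2.ne hj
  · rintro ⟨-, hv⟩
    obtain ⟨τ, hτ⟩ := exists_isLeast_outcome fun j => (π j : ℕ)
    have hp := isParked_of_isLeast hτ
    have hlt : ∀ j, τ j < n := fun j =>
      hp.lt_of_notMem_range (hp.vacant_iff.1 hv) (π j).2.le
    refine ⟨fun j => ⟨τ j, hlt j⟩, fun j => ⟨⟨(hτ j).1.1, fun l hl h => ?_⟩, fun s hs => ?_⟩⟩
    · exact (hτ j).1.2 l hl (congrArg Fin.val h)
    · exact (hτ j).2 ⟨hs.1, fun l hl h => hs.2 l hl (Fin.ext h)⟩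

/-- The unattempted spots are the vacant ones; the shift comes from counting spots from `1`. -/
theorem isUnattempted_succ_iff (hπ : π ∈ parkingFunctions m n) (s : ℕ) :
    IsUnattempted π (s + 1) ↔ s < n ∧ Vacant (fun j => (π j : ℕ)) s := by
  constructor
  · rintro ⟨t, ht, τ, hτ, h⟩
    obtain rfl : (t : ℕ) = s := by omega
    refine ⟨t.2, hτ.isParked.vacant_iff.2 ?_⟩
    rintro ⟨j, hj⟩
    obtain rfl : τ j = t := Fin.ext hj
    exact h j ⟨(hτ j).1.1, le_rfl⟩
  · rintro ⟨hs, hv⟩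
    obtain ⟨τ, hτ⟩ := hπ
    refine ⟨⟨s, hs⟩, rfl, τ, hτ, ?_⟩
    rintro j ⟨h1, h2⟩
    have := hτ.isParked.lt_of_notMem_range (hτ.isParked.vacant_iff.1 hv) (j := j) h1
    exact absurd this (not_lt.2 h2)

theorem unattemptedSpot_eq (hπ : π ∈ parkingFunctions m n) {a : ℕ} (ha : m + a < n) :
    unattemptedSpot (a + 1) π = Nat.nth (Vacant fun j => (π j : ℕ)) a + 1 := by
  classical
  have hinf := infinite_vacant fun j => (π j : ℕ)
  have hlt := nth_vacant_lt (mem_parkingFunctions_iff.1 hπ) (a := a) (by simpa using ha)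
  have hv := Nat.nth_mem_of_infinite hinf a
  have hc := Nat.count_nth_of_infinite hinf a
  set q := Nat.nth (Vacant fun j => (π j : ℕ)) a
  have hcount : Nat.count (IsUnattempted π) (q + 1) = a := by
    rw [Nat.count_succ', if_neg (by rintro ⟨s, hs, -⟩; omega), add_zero, ← hc,
      Nat.count_eq_card_filter_range, Nat.count_eq_card_filter_range]
    congr 1
    refine Finset.filter_congr fun s hs => ?_
    rw [isUnattempted_succ_iff hπ]
    exact and_iff_right ((Finset.mem_range.1 hs).trans hlt)
  rw [unattemptedSpot, Nat.add_sub_cancel]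
  nth_rw 1 [← hcount]
  exact Nat.nth_count ((isUnattempted_succ_iff hπ q).2 ⟨hlt, hv⟩)

theorem sum_parkingFunctions (G : (Fin m → ℕ) → ℝ) [Fintype (parkingFunctions m n)] :
    ∑ π ∈ (parkingFunctions m n).toFinset, G (fun j => (π j : ℕ)) =
      ∑ f ∈ parkFun (Fin m) n, G f := by
  refine Finset.sum_bij (fun π _ j => (π j : ℕ)) ?_ ?_ ?_ ?_
  · intro π hπ
    exact mem_parkingFunctions_iff.1 (by simpa using hπ)
  · intro π _ π' _ h
    funext j
    exact Fin.ext (congrFun h j)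
  · intro f hf
    refine ⟨fun j => ⟨f j, (mem_parkFun.1 hf).1 j⟩, ?_, rfl⟩
    simpa [mem_parkingFunctions_iff] using hf
  · intro π _
    rfl

theorem integral_uniformOn_parkingFunctions {g : (Fin m → Fin n) → ℝ} (G : (Fin m → ℕ) → ℝ)
    (hg : ∀ π ∈ parkingFunctions m n, g π = G fun j => (π j : ℕ)) :
    ∫ π, g π ∂(uniformOn (parkingFunctions m n)) =
      (∑ f ∈ parkFun (Fin m) n, G f) / (parkFun (Fin m) n).card := by
  classical
  have hcard : ((parkingFunctions m n).toFinset.card : ℝ) = (parkFun (Fin m) n).card := by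
    simpa using sum_parkingFunctions (m := m) (n := n) fun _ => 1
  rw [uniformOn, ProbabilityTheory.cond, MeasureTheory.integral_smul_measure]
  nth_rw 2 [← Set.coe_toFinset (parkingFunctions m n)]
  rw [MeasureTheory.setIntegral_finset,
    ← sum_parkingFunctions, ← hcard]
  · have h1 : MeasureTheory.Measure.count (parkingFunctions m n) =
        (parkingFunctions m n).toFinset.card := by
      nth_rw 1 [← Set.coe_toFinset (parkingFunctions m n)]
      rw [MeasureTheory.Measure.count_apply_finset]
    rw [h1]
    simp only [MeasureTheory.measureReal_def, MeasureTheory.Measure.count_singleton,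
      ENNReal.toReal_one, one_mul, ENNReal.toReal_inv, ENNReal.toReal_natCast, smul_eq_mul]
    rw [inv_mul_eq_div, Finset.sum_congr rfl fun π hπ => hg π (by simpa using hπ)]
  · exact MeasureTheory.Integrable.of_finite.integrableOn

end

/-! ### The covariance -/

theorem parkCount_pos (m b : ℕ) : 0 < parkCount m (b + 1) := by
  have h := parkCount_eq m b
  have : 0 < ((m : ℝ) + (b + 1 : ℕ)) := by positivity
  refine pos_of_mul_pos_right (a := (m : ℝ) + (b + 1 : ℕ)) ?_ this.le
  rw [h]
  positivity

/-- The cars are exchangeable, as their order does not affect which spots stay vacant. -/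
theorem sum_apply_mul_nth_vacant (m n : ℕ) (φ : (ℕ → Prop) → ℝ) :
    (m + 1 : ℕ) * ∑ f ∈ parkFun (Fin (m + 1)) n, (f 0 : ℝ) * φ (Vacant f) =
      ∑ f ∈ parkFun (Fin (m + 1)) n, φ (Vacant f) * ∑ j, (f j : ℝ) := by
  simp only [Finset.mul_sum (s := Finset.univ)]
  rw [Finset.sum_comm]
  have h : ∀ j, ∑ f ∈ parkFun (Fin (m + 1)) n, φ (Vacant f) * (f j : ℝ) =
      ∑ f ∈ parkFun (Fin (m + 1)) n, (f 0 : ℝ) * φ (Vacant f) := by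
    intro j
    rw [← sum_parkFun_comp_equiv (Equiv.swap 0 j)]
    refine Finset.sum_congr rfl fun f _ => ?_
    rw [vacant_comp_equiv, Function.comp_apply, Equiv.swap_apply_right, mul_comm]
  rw [Finset.sum_congr rfl fun j _ => h j, Finset.sum_const, Finset.card_univ, Fintype.card_fin,
    nsmul_eq_mul]

/-- The exact covariance. Here there are `m + 1` cars, and `a + b + 2` is the number `d` of blocks, so
that `m + 1 + (a + b + 2)` is the number `M` of spots including the unused one after the row. -/
theorem covFirstSpot_eq (m a b : ℕ) :
    covFirstSpot (m + 1) (m + 1 + a + b + 1) (a + 1) =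
      ((a : ℝ) + 1) * (b + 1) / (2 * (a + b + 1)) * ((m + 1 + (a + b + 2)) / (m + 1)) *
        ((m + 1 + (a + b + 2)) / (a + b + 2) - momentSum (m + 1) (m + 1 + (a + b + 2))) := by
  set n := m + 1 + a + b + 1 with hn
  have hpos : 0 < parkCount (m + 1) (a + b + 2) := parkCount_pos (m + 1) (a + b + 1)
  have hcard : ((parkFun (Fin (m + 1)) n).card : ℝ) = parkCount (m + 1) (a + b + 2) :=
    card_parkFun _ _ _ (by simp) (by omega)
  have hne : (parkFun (Fin (m + 1)) n).Nonempty := by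
    rw [← Finset.card_pos]
    exact_mod_cast hcard ▸ hpos
  have hprob : MeasureTheory.IsProbabilityMeasure (uniformOn (parkingFunctions (m + 1) n)) := by
    refine isProbabilityMeasure_uniformOn (Set.toFinite _) ?_
    obtain ⟨f, hf⟩ := hne
    exact ⟨fun j => ⟨f j, (mem_parkFun.1 hf).1 j⟩, mem_parkingFunctions_iff.2 hf⟩
  have hX : ∀ π ∈ parkingFunctions (m + 1) n, (firstCoordinate π : ℝ) =
      (fun f : Fin (m + 1) → ℕ => (f 0 : ℝ) + 1) fun j => (π j : ℕ) := by
    intro π _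
    simp [firstCoordinate]
  have hY : ∀ π ∈ parkingFunctions (m + 1) n, (unattemptedSpot (a + 1) π : ℝ) =
      (fun f : Fin (m + 1) → ℕ => (Nat.nth (Vacant f) a : ℝ) + 1) fun j => (π j : ℕ) := by
    intro π hπ
    rw [unattemptedSpot_eq hπ (by omega)]
    push_cast
    rfl
  rw [covFirstSpot, covariance_eq_sub MeasureTheory.MemLp.of_discrete
    MeasureTheory.MemLp.of_discrete, integral_uniformOn_parkingFunctions
      (fun f => ((f 0 : ℝ) + 1) * ((Nat.nth (Vacant f) a : ℝ) + 1))
      (fun π hπ => by simp only [Pi.mul_apply, hX π hπ, hY π hπ]),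
    integral_uniformOn_parkingFunctions (fun f => (f 0 : ℝ) + 1) hX,
    integral_uniformOn_parkingFunctions (fun f => (Nat.nth (Vacant f) a : ℝ) + 1) hY, hcard]
  have e1 := sum_apply_mul_nth_vacant m n fun p => (Nat.nth p a : ℝ) + 1
  have e2 := sum_apply_mul_nth_vacant m n fun _ => 1
  simp only [mul_one, one_mul] at e2
  have e3 : ∑ f ∈ parkFun (Fin (m + 1)) n, ∑ j, (f j : ℝ) = parkSum (m + 1) (a + b + 2) :=
    sum_sum_parkFun _ _ _ (by simp) (by omega)
  have e4 := sum_nth_vacant_add_one (m + 1) a b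
  have e5 := sum_nth_vacant_mul_sum_sub (m + 1) a b
  have e6 : ((a + b + 2 : ℕ) : ℝ) * _ = _ := sum_sq_first_vacant (m + 1) (a + b)
  rw [← hn] at e4 e5
  rw [e3] at e2
  rw [← e1, ← e2] at e5
  simp only [add_one_mul (_ : ℝ), Finset.sum_add_distrib, Finset.sum_const, nsmul_eq_mul, mul_one,
    hcard] at e4 e5 ⊢
  push_cast at e4 e5 e6 ⊢
  generalize ∑ f ∈ parkFun (Fin (m + 1)) n, (f 0 : ℝ) * ((Nat.nth (Vacant f) a : ℝ) + 1) = Q at *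
  generalize ∑ f ∈ parkFun (Fin (m + 1)) n, (f 0 : ℝ) = S at *
  generalize ∑ f ∈ parkFun (Fin (m + 1)) n, (Nat.nth (Vacant f) a : ℝ) +
    parkCount (m + 1) (a + b + 2) = K at *
  generalize ∑ s ∈ Finset.range (m + 1 + 1), ((m + 1).choose s : ℝ) *
    ((s + 1) ^ 2 * parkCount s 1 * parkCount (m + 1 - s) (a + b + 1)) = B at *
  generalize parkCount (m + 1) (a + b + 2) = P at *
  generalize momentSum (m + 1) (m + 1 + (a + b + 2)) = μ at *
  have hd : (a : ℝ) + b + 2 ≠ 0 := by positivity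
  have hd' : (a : ℝ) + b + 1 ≠ 0 := by positivity
  have hm : (m : ℝ) + 1 ≠ 0 := by positivity
  have hP : P ≠ 0 := hpos.ne'
  have hL : (Q + K) / P - (S + P) / P * (K / P) = (Q * P - S * K) / P ^ 2 := by
    field_simp
    ring
  have hR : ((a : ℝ) * (b + 1) + (b + 1)) / (2 * (a + b + 1)) * ((m + 1 + (a + b + 2)) / (m + 1)) *
      ((m + 1 + (a + b + 2)) / (a + b + 2) - μ) = (a + 1) * (b + 1) * (m + 1 + (a + b + 2)) *
        ((m + 1 + (a + b + 2)) - (a + b + 2) * μ) /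
        (2 * (a + b + 1) * (a + b + 2) * (m + 1)) := by
    field_simp
  rw [hL, hR, div_eq_div_iff (by positivity) (by positivity)]
  linear_combination P * e5 - 2 * ((a : ℝ) + b + 1) * (m + 1) * S * e4 -
    ((a : ℝ) + 1) * (b + 1) * (a + b + 2) * P * e6

theorem mainTheorem7 (i : ℕ) (hi : 1 ≤ i) (c : ℝ) (hc0 : 0 < c) (hc1 : c < 1)
    (m n : ℕ → ℕ) (hn : Tendsto n atTop atTop)
    (hmn : Tendsto (fun N => (m N : ℝ) / (n N : ℝ)) atTop (𝓝 c)) :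
    (fun N => covFirstSpot (m N) (n N) i) ~[atTop]
      (fun _ => -((i : ℝ) / (2 * (1 - c) ^ 2))) := by
  have hc : 1 - c ≠ 0 := by linarith
  have hi0 : (i : ℝ) ≠ 0 := by positivity
  refine (isEquivalent_const_iff_tendsto (neg_ne_zero.2 (by positivity))).2 ?_
  have hnR : Tendsto (fun N => (n N : ℝ)) atTop atTop := tendsto_natCast_atTop_atTop.comp hn
  have hnpos : ∀ᶠ N in atTop, 0 < n N := hn.eventually_gt_atTop 0
  have hmR : Tendsto (fun N => (m N : ℝ)) atTop atTop := by
    refine (hmn.pos_mul_atTop hc0 hnR).congr' ?_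
    filter_upwards [hnpos] with N hN
    field_simp
  have hm : Tendsto m atTop atTop := tendsto_natCast_atTop_iff.1 hmR
  have hdR : Tendsto (fun N => (n N : ℝ) - m N) atTop atTop := by
    refine ((hmn.const_sub 1).pos_mul_atTop (by linarith) hnR).congr' ?_
    filter_upwards [hnpos] with N hN
    field_simp
  have hM : Tendsto (fun N => n N + 1) atTop atTop := (tendsto_add_atTop_nat 1).comp hn
  have hmM : Tendsto (fun N => (m N : ℝ) / (n N + 1 : ℕ)) atTop (𝓝 c) := by
    have h := hmn.mul ((tendsto_natCast_div_add_atTop (1 : ℝ)).comp hn)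
    rw [mul_one] at h
    refine h.congr' ?_
    filter_upwards [hnpos] with N hN
    simp only [Function.comp_apply]
    push_cast
    field_simp
  -- The exact covariance in terms of `m / (n + 1)`; the factor `(d - i) / (d - 1)`, where
  -- `d = n + 1 - m`, is written as `1 - (i - 1) / (n - m)`.
  have hlim : Tendsto (fun N => (i : ℝ) * (1 - ((i : ℝ) - 1) / ((n N : ℝ) - m N)) / 2 *
      ((m N : ℝ) / (n N + 1 : ℕ))⁻¹ *
      ((1 - (m N : ℝ) / (n N + 1 : ℕ))⁻¹ - momentSum (m N) (n N + 1))) atTop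
      (𝓝 ((i : ℝ) * (1 - 0) / 2 * c⁻¹ * ((1 - c)⁻¹ - 1 / (1 - c) ^ 2))) :=
    ((((hdR.const_div_atTop _).const_sub 1).const_mul _).div_const 2 |>.mul (hmM.inv₀ hc0.ne')).mul
      (((hmM.const_sub 1).inv₀ hc).sub (tendsto_momentSum hc0 hc1 hM hmM hm))
  have hval : (i : ℝ) * (1 - 0) / 2 * c⁻¹ * ((1 - c)⁻¹ - 1 / (1 - c) ^ 2) =
      -((i : ℝ) / (2 * (1 - c) ^ 2)) := by
    field_simp
    ring
  rw [hval] at hlim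
  refine hlim.congr' ?_
  filter_upwards [hm.eventually_ge_atTop 1, hdR.eventually_ge_atTop (i : ℝ)] with N h1 h2
  obtain ⟨a, rfl⟩ : ∃ a, i = a + 1 := ⟨i - 1, by omega⟩
  obtain ⟨l, hl⟩ : ∃ l, m N = l + 1 := ⟨m N - 1, by omega⟩
  have h3 : a + 1 + m N ≤ n N := by
    have : ((a + 1 + m N : ℕ) : ℝ) ≤ n N := by push_cast at h2 ⊢; linarith
    exact_mod_cast this
  obtain ⟨b, hb⟩ : ∃ b, n N = l + 1 + a + b + 1 := ⟨n N - (l + 1 + a + 1), by omega⟩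
  rw [hl, hb, covFirstSpot_eq, show l + 1 + a + b + 1 + 1 = l + 1 + (a + b + 2) by ring]
  push_cast
  have e1 : (l : ℝ) + 1 + a + b + 1 - (l + 1) = a + b + 1 := by ring
  have e2 : (1 : ℝ) - (l + 1) / (l + 1 + (a + b + 2)) =
      (a + b + 2) / (l + 1 + (a + b + 2)) := by
    field_simp
    ring
  rw [e1, e2, inv_div, inv_div]
  field_simp
  ring
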